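/- Let $a\in\mathbb{C}$ with $a\notin\mathbb{Z}$, and let $x\in\mathbb{C}$ with $|x|<1$ and $x\notin(-1,0]$. Let $(a)_n=a(a+1)\cdots(a+n-1)$, $H_n=\sum_{k=1}^n\frac1k$, $\psi=\Gamma'/\Gamma$, let $\log$ be the principal logarithm, and let ${}_2F_1(a,b;c;z)=\sum_{n\ge 0}\frac{(a)_n(b)_n}{n!\,(c)_n}z^n$ for $|z|<1$, extended to $\mathbb{C}\setminus[1,\infty)$ by analytic continuation. Then $$\sum_{n=1}^\infty\frac{(a)_n(1-a)_n}{(n!)^2}H_n x^n=\frac{\pi}{2\sin\pi a}\,{}_2F_1(a,1-a;1;1-x)+\frac12\left(\psi\left(1-\tfrac a2\right)+\psi\left(\tfrac{a+1}2\right)-\psi(1)-\psi\left(\tfrac12\right)-\frac{\pi}{\sin\pi a}-\log\frac{1-x}{x}\right){}_2F_1(a,1-a;1;x),$$ where the series on the left converges absolutely. -/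

import Mathlib

open Filter Topology

/-- The Gauss hypergeometric function `₂F₁(a, b; c; z)` (`c` not a nonpositive integer) on the
plane cut along `[1, ∞)`: the analytic continuation of the hypergeometric series along the
straight segment from `0` to `z` (and `0` if there is no such continuation). -/
noncomputable def gaussHyp (a b c z : ℂ) : ℂ :=
  open Classical in
  if h : ∃ f : ℂ → ℂ, AnalyticOnNhd ℂ f (segment ℝ 0 z) ∧ f =ᶠ[𝓝 0] ₂F₁ a b c then
    h.choose z
  else 0

/-- The value does not depend on the choice of the continuation. -/
theorem gaussHyp_eq_of_analyticOnNhd {a b c z : ℂ} {f : ℂ → ℂ}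
    (hf : AnalyticOnNhd ℂ f (segment ℝ 0 z)) (h0 : f =ᶠ[𝓝 0] ₂F₁ a b c) :
    gaussHyp a b c z = f z := by
  have h : ∃ f : ℂ → ℂ, AnalyticOnNhd ℂ f (segment ℝ 0 z) ∧ f =ᶠ[𝓝 0] ₂F₁ a b c := ⟨f, hf, h0⟩
  have hs := h.choose_spec
  rw [gaussHyp, dif_pos h]
  exact hs.1.eqOn_of_preconnected_of_eventuallyEq hf
    (convex_segment (0 : ℂ) z).isPreconnected (left_mem_segment ℝ 0 z) (hs.2.trans h0.symm)
    (right_mem_segment ℝ 0 z)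

/-- The hypergeometric series converges in the unit disc. -/
theorem one_le_radius_hyp (a b c : ℂ) :
    1 ≤ (ordinaryHypergeometricSeries ℂ a b c).radius := by
  by_cases h : ∀ k : ℕ, (k : ℂ) ≠ -a ∧ (k : ℂ) ≠ -b ∧ (k : ℂ) ≠ -c
  · exact (ordinaryHypergeometricSeries_radius_eq_one ℂ a b c h).ge
  · push Not at h
    obtain ⟨k, hk⟩ := h
    by_cases h1 : (k : ℂ) = -a
    · obtain rfl : a = -(k : ℂ) := by rw [h1, neg_neg]
      rw [ordinaryHypergeometric_radius_top_of_neg_nat₁]; exact le_top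
    by_cases h2 : (k : ℂ) = -b
    · obtain rfl : b = -(k : ℂ) := by rw [h2, neg_neg]
      rw [ordinaryHypergeometric_radius_top_of_neg_nat₂]; exact le_top
    · obtain rfl : c = -(k : ℂ) := by rw [hk h1 h2, neg_neg]
      rw [ordinaryHypergeometric_radius_top_of_neg_nat₃]; exact le_top

/-- In the unit disc the function is the sum of the hypergeometric series. -/
theorem gaussHyp_eq_of_norm_lt_one (a b c : ℂ) {z : ℂ} (hz : ‖z‖ < 1) :
    gaussHyp a b c z = ₂F₁ a b c z := by
  have hr := one_le_radius_hyp a b c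
  have hp := (ordinaryHypergeometricSeries ℂ a b c).hasFPowerSeriesOnBall
    (lt_of_lt_of_le zero_lt_one hr)
  refine gaussHyp_eq_of_analyticOnNhd (hp.analyticOnNhd.mono ?_) (EventuallyEq.refl _ _)
  intro w hw
  have hwb : w ∈ Metric.ball (0 : ℂ) 1 :=
    (convex_ball (0 : ℂ) 1).segment_subset (Metric.mem_ball_self one_pos) (by simpa using hz) hw
  refine Metric.eball_subset_eball hr ?_
  rw [← ENNReal.ofReal_one, Metric.eball_ofReal]
  exact hwb

/-! Write F for ₂F₁(a, 1 - a; 1; ·) and g for its twist by harmonic numbers. F solves (z(1 - z)F')'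
= a(1 - a)F, and since H_{n+1} - H_n = 1/(n + 1), g solves the same equation with the extra term F'
on the right. Hence K = 2g + log((1 - z)/z) F, which is `hypLog`, is a second solution of the
homogeneous equation. The equation is invariant under z ↦ 1 - z, so F(1 - z) = αF + βK, and solving
for g gives the theorem once α and β are known.

The coefficients are ratios of Wronskians (times z(1 - z)), which are constant. That of F and K is
read off at 0. The other two are evaluated at 1/2, which is fixed by z ↦ 1 - z and where the
logarithm vanishes. This leaves g(1/2) and F(1/2)F'(1/2).

Both come from Bailey's closed form for ₂F₁(a, 1 - a; c; 1/2) (`hypHalf_mul_Gamma`). Its derivative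
in c at c = 1 gives g(1/2) in terms of digamma values (`powSum_harmCoeff_half`). Its cases c = 1 and
c = 2, with the reflection formula, give F(1/2)F'(1/2) = 2 sin(πa)/π (`hypHalf_mul_deriv`). The
connection formula (`powSum_hypCoeff_one_sub`) is proved on the lens |z| < 1, |1 - z| < 1 and then
carried to the slit disc by analytic continuation (`gaussHyp_one_sub`). -/

/-! ### Power series in the open unit disc, handled through their coefficients. -/

/-- The power series with coefficients `u` converges absolutely in the open unit disc. -/
def DiscSummable (u : ℕ → ℂ) : Prop :=
  ∀ r : ℝ, 0 ≤ r → r < 1 → Summable fun n => ‖u n‖ * r ^ n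

/-- The sum of the power series with coefficients `u`. -/
noncomputable def powSum (u : ℕ → ℂ) (z : ℂ) : ℂ := ∑' n, u n * z ^ n

/-- Multiplication of a power series by the variable, on coefficients. -/
def shiftCoeff (u : ℕ → ℂ) : ℕ → ℂ
  | 0 => 0
  | n + 1 => u n

/-- Differentiation of a power series, on coefficients. -/
def derivCoeff (u : ℕ → ℂ) (n : ℕ) : ℂ := (n + 1) * u (n + 1)

namespace DiscSummable

variable {u v : ℕ → ℂ} {z : ℂ}

theorem of_le (hv : DiscSummable v) (h : ∀ n, ‖u n‖ ≤ ‖v n‖) : DiscSummable u := fun r h0 h1 =>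
  (hv r h0 h1).of_nonneg_of_le (fun n => by positivity) fun n => by
    have := h n
    gcongr

theorem of_ratio {ρ : ℕ → ℝ} (hρ : Tendsto ρ atTop (𝓝 1))
    (h : ∀ n, ‖u (n + 1)‖ = ρ n * ‖u n‖) : DiscSummable u := by
  intro r h0 h1
  obtain ⟨q, hq, hq1⟩ := exists_between h1
  have hlim : Tendsto (fun n => ρ n * r) atTop (𝓝 (1 * r)) := hρ.mul_const r
  rw [one_mul] at hlim
  refine summable_of_ratio_norm_eventually_le hq1 ?_
  filter_upwards [hlim.eventually_le_const hq] with n hn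
  simp only [norm_mul, norm_norm, norm_pow, Real.norm_of_nonneg h0]
  rw [h n]
  calc ρ n * ‖u n‖ * r ^ (n + 1) = (ρ n * r) * (‖u n‖ * r ^ n) := by ring
    _ ≤ q * (‖u n‖ * r ^ n) := by gcongr

theorem summable (hu : DiscSummable u) (hz : ‖z‖ < 1) : Summable fun n => u n * z ^ n :=
  .of_norm (by simpa using hu ‖z‖ (norm_nonneg _) hz)

theorem hasSum (hu : DiscSummable u) (hz : ‖z‖ < 1) :
    HasSum (fun n => u n * z ^ n) (powSum u z) := (hu.summable hz).hasSum

theorem natCast_mul (hu : DiscSummable u) : DiscSummable fun n => (n : ℂ) * u n := by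
  intro r h0 h1
  -- The factor n is absorbed by passing to a larger radius q < 1, since n (r/q)^n is bounded.
  obtain ⟨q, hq, hq1⟩ := exists_between h1
  have hq0 : 0 < q := h0.trans_lt hq
  have hlim : Tendsto (fun n : ℕ => (n : ℝ) * (r / q) ^ n) atTop (𝓝 0) :=
    tendsto_self_mul_const_pow_of_lt_one (by positivity) ((div_lt_one hq0).2 hq)
  obtain ⟨C, hC⟩ := hlim.bddAbove_range
  refine ((hu q hq0.le hq1).mul_left C).of_nonneg_of_le (fun n => by positivity) fun n => ?_
  have hn : (n : ℝ) * (r / q) ^ n ≤ C := hC ⟨n, rfl⟩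
  calc ‖(n : ℂ) * u n‖ * r ^ n = ((n : ℝ) * (r / q) ^ n) * (‖u n‖ * q ^ n) := by
        rw [norm_mul, Complex.norm_natCast, div_pow]; field_simp
    _ ≤ C * (‖u n‖ * q ^ n) := by gcongr

theorem shift (hu : DiscSummable u) : DiscSummable (shiftCoeff u) := by
  intro r h0 h1
  rw [← summable_nat_add_iff 1]
  simpa [shiftCoeff, pow_succ, mul_assoc] using (hu r h0 h1).mul_right r

theorem sub (hu : DiscSummable u) (hv : DiscSummable v) : DiscSummable (u - v) := by
  intro r h0 h1
  refine ((hu r h0 h1).add (hv r h0 h1)).of_nonneg_of_le (fun n => by positivity) fun n => ?_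
  rw [← add_mul]
  have := norm_sub_le (u n) (v n)
  simp only [Pi.sub_apply]
  gcongr

theorem tail (hu : DiscSummable u) : DiscSummable fun n => u (n + 1) := by
  intro r h0 h1
  obtain ⟨q, hq, hq1⟩ := exists_between h1
  have hq0 : 0 < q := h0.trans_lt hq
  have := ((summable_nat_add_iff 1).2 (hu q hq0.le hq1)).mul_right q⁻¹
  refine this.of_nonneg_of_le (fun n => by positivity) fun n => ?_
  rw [pow_succ, mul_assoc, mul_assoc, mul_inv_cancel₀ hq0.ne', mul_one]
  gcongr

theorem deriv (hu : DiscSummable u) : DiscSummable (derivCoeff u) := by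
  have h := hu.natCast_mul.tail
  push_cast at h
  exact h

theorem powSum_shift (hu : DiscSummable u) (hz : ‖z‖ < 1) :
    powSum (shiftCoeff u) z = z * powSum u z := by
  have h : HasSum (fun n => shiftCoeff u (n + 1) * z ^ (n + 1)) (z * powSum u z) := by
    refine ((hu.hasSum hz).mul_left z).congr_fun fun n => ?_
    simp only [shiftCoeff]; ring
  have := (hasSum_nat_add_iff (f := fun n => shiftCoeff u n * z ^ n) 1).1 h
  simpa [shiftCoeff, powSum] using this.tsum_eq

theorem powSum_sub (hu : DiscSummable u) (hv : DiscSummable v) (hz : ‖z‖ < 1) :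
    powSum (u - v) z = powSum u z - powSum v z := by
  simpa [sub_mul, powSum] using ((hu.hasSum hz).sub (hv.hasSum hz)).tsum_eq

theorem hasDerivAt (hu : DiscSummable u) (hz : ‖z‖ < 1) :
    HasDerivAt (powSum u) (powSum (derivCoeff u) z) z := by
  obtain ⟨r, hr, hr1⟩ := exists_between hz
  have hr0 : 0 ≤ r := (norm_nonneg z).trans hr.le
  have hdiff : ∀ n, DifferentiableOn ℂ (fun w : ℂ => u n * w ^ n) (Metric.ball 0 r) := fun n => by
    fun_prop
  have hle : ∀ n, ∀ w ∈ Metric.ball (0 : ℂ) r, ‖u n * w ^ n‖ ≤ ‖u n‖ * r ^ n := by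
    intro n w hw
    rw [norm_mul, norm_pow]
    have : ‖w‖ ≤ r := by simpa using (mem_ball_zero_iff.1 hw).le
    gcongr
  have hzr : z ∈ Metric.ball (0 : ℂ) r := mem_ball_zero_iff.2 hr
  have hd : DifferentiableAt ℂ (powSum u) z :=
    (Complex.differentiableOn_tsum_of_summable_norm (hu r hr0 hr1) hdiff Metric.isOpen_ball
      hle).differentiableAt (Metric.isOpen_ball.mem_nhds hzr)
  have hs := Complex.hasSum_deriv_of_summable_norm (hu r hr0 hr1) hdiff Metric.isOpen_ball hle hzr
  have hs' := (hasSum_nat_add_iff' 1).2 hs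
  have he : HasSum (fun n => derivCoeff u n * z ^ n) (_root_.deriv (powSum u) z) := by
    have h0 : _root_.deriv (fun w => ∑' i, u i * w ^ i) z -
        ∑ i ∈ Finset.range 1, _root_.deriv (fun w => u i * w ^ i) z =
        _root_.deriv (powSum u) z := by simp; rfl
    rw [h0] at hs'
    refine hs'.congr_fun fun n => ?_
    simp [derivCoeff]; ring
  have := hd.hasDerivAt
  rwa [← he.tsum_eq] at this

/-- The operator `Φ ↦ (z (1 - z) Φ')'` on power series. -/
theorem hasDerivAt_mul_powSum_deriv (hu : DiscSummable u) (hz : ‖z‖ < 1) :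
    HasDerivAt (fun w => w * (1 - w) * powSum (derivCoeff u) w)
      (powSum (fun n => (n + 1) ^ 2 * u (n + 1) - n * (n + 1) * u n) z) z := by
  -- On coefficients, z(1 - z)u' is the once shifted derivative minus the twice shifted one.
  have h1 := hu.deriv.shift
  have h2 := (h1.sub h1.shift).hasDerivAt hz
  have hc : derivCoeff (shiftCoeff (derivCoeff u) - shiftCoeff (shiftCoeff (derivCoeff u))) =
      fun n : ℕ => ((n : ℂ) + 1) ^ 2 * u (n + 1) - n * (n + 1) * u n := by
    funext n
    rcases n with _ | n
    · simp [derivCoeff, shiftCoeff]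
    · simp [derivCoeff, shiftCoeff]
      ring
  rw [hc] at h2
  refine h2.congr_of_eventuallyEq ?_
  filter_upwards [Metric.isOpen_ball.mem_nhds (mem_ball_zero_iff.2 hz)] with w hw
  rw [mem_ball_zero_iff] at hw
  rw [powSum_sub h1 h1.shift hw, h1.powSum_shift hw, hu.deriv.powSum_shift hw]
  ring

end DiscSummable

/-! ### Pochhammer symbols and hypergeometric coefficients. -/

/-- The Pochhammer symbol `(a)ₙ`. -/
noncomputable def poch (a : ℂ) (n : ℕ) : ℂ := (ascPochhammer ℂ n).eval a

@[simp] theorem poch_zero (a : ℂ) : poch a 0 = 1 := by simp [poch]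

theorem poch_succ (a : ℂ) (n : ℕ) : poch a (n + 1) = poch a n * (a + n) := by
  simp [poch, ascPochhammer_succ_eval]

theorem poch_one (n : ℕ) : poch 1 n = n.factorial := by simp [poch, ascPochhammer_eval_one]

theorem poch_two (n : ℕ) : poch 2 n = (n + 1) * n.factorial := by
  induction n with
  | zero => simp
  | succ n ih => rw [poch_succ, ih, Nat.factorial_succ]; push_cast; ring

theorem add_natCast_ne_zero_of_re_pos {c : ℂ} (hc : 0 < c.re) (n : ℕ) : c + n ≠ 0 := fun h => by
  have h2 : 0 < (c + n).re := by simp only [Complex.add_re, Complex.natCast_re]; positivity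
  rw [h, Complex.zero_re] at h2
  exact lt_irrefl _ h2

theorem poch_ne_zero_of_re_pos {c : ℂ} (hc : 0 < c.re) (n : ℕ) : poch c n ≠ 0 := by
  induction n with
  | zero => simp
  | succ n ih => rw [poch_succ]; exact mul_ne_zero ih (add_natCast_ne_zero_of_re_pos hc n)

theorem poch_eq_prod (a : ℂ) (n : ℕ) : poch a n = ∏ j ∈ Finset.range n, (a + j) := by
  induction n with
  | zero => simp
  | succ n ih => rw [poch_succ, ih, Finset.prod_range_succ]

theorem poch_add_two (c : ℂ) (n : ℕ) :
    c * (c + 1) * poch (c + 2) n = poch c n * (c + n) * (c + n + 1) := by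
  induction n with
  | zero => simp
  | succ n ih => rw [poch_succ, poch_succ, ← mul_assoc, ih]; push_cast; ring

theorem norm_poch_half_le {c : ℂ} (hc : 1 / 2 ≤ c.re) (n : ℕ) :
    ‖poch (1 / 2) n‖ ≤ ‖poch c n‖ := by
  induction n with
  | zero => simp
  | succ n ih =>
    rw [poch_succ, poch_succ, norm_mul, norm_mul]
    have h1 : ‖(1 / 2 : ℂ) + n‖ = 1 / 2 + n := by
      have : (1 / 2 : ℂ) + n = ((1 / 2 + n : ℝ) : ℂ) := by push_cast; ring
      rw [this, Complex.norm_of_nonneg (by positivity)]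
    have h2 : (1 / 2 : ℝ) + n ≤ ‖c + n‖ := by
      refine le_trans ?_ (Complex.re_le_norm _)
      simpa using hc
    rw [h1]
    gcongr

/-- The coefficients of `₂F₁(a, 1 - a; c; z)`. -/
noncomputable def hypCoeff (a c : ℂ) (n : ℕ) : ℂ :=
  poch a n * poch (1 - a) n / (n.factorial * poch c n)

theorem hypCoeff_zero (a c : ℂ) : hypCoeff a c 0 = 1 := by simp [hypCoeff]

theorem hypCoeff_succ (a : ℂ) {c : ℂ} (hc : 0 < c.re) (n : ℕ) :
    hypCoeff a c (n + 1) =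
      (a + n) * (1 - a + n) / ((n + 1) * (c + n)) * hypCoeff a c n := by
  have h1 := poch_ne_zero_of_re_pos hc n
  have h2 := add_natCast_ne_zero_of_re_pos hc n
  have h3 : (n.factorial : ℂ) ≠ 0 := mod_cast n.factorial_ne_zero
  have h4 : (n : ℂ) + 1 ≠ 0 := n.cast_add_one_ne_zero
  simp only [hypCoeff, poch_succ, Nat.factorial_succ]
  push_cast
  field_simp

theorem tendsto_add_natCast_div (x y : ℂ) :
    Tendsto (fun n : ℕ => (x + n) / (y + n)) atTop (𝓝 1) := by
  have h (w : ℂ) : Tendsto (fun n : ℕ => w / n + 1) atTop (𝓝 1) := by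
    simpa using (tendsto_const_div_atTop_nhds_zero_nat w).add_const 1
  have := (h x).div (h y) one_ne_zero
  rw [div_one] at this
  refine this.congr' ?_
  filter_upwards [eventually_ne_atTop 0] with n hn
  have hn' : (n : ℂ) ≠ 0 := mod_cast hn
  simp only [Pi.div_apply]
  rw [← mul_div_mul_right _ _ hn']
  congr 1 <;> field_simp

theorem discSummable_hypCoeff (a : ℂ) {c : ℂ} (hc : 0 < c.re) : DiscSummable (hypCoeff a c) := by
  refine .of_ratio (ρ := fun n => ‖(a + n) / (1 + n) * ((1 - a + n) / (c + n))‖) ?_ fun n => ?_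
  · simpa using ((tendsto_add_natCast_div a 1).mul (tendsto_add_natCast_div (1 - a) c)).norm
  · rw [hypCoeff_succ a hc, norm_mul, div_mul_div_comm, add_comm (1 : ℂ) n]

/-- Factor by factor, |c + j| ≥ Re c + j ≥ 1/2 + j. This gives a majorant uniform in c on a
half-plane whose interior contains 1, used both for the limit c → ∞ and for differentiating in c at
1. -/
theorem norm_hypCoeff_le (a : ℂ) {c : ℂ} (hc : 1 / 2 ≤ c.re) (n : ℕ) :
    ‖hypCoeff a c n‖ ≤ ‖hypCoeff a (1 / 2) n‖ := by
  have h1 := norm_pos_iff.2 (poch_ne_zero_of_re_pos (c := 1 / 2) (by norm_num) n)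
  have h2 := norm_poch_half_le hc n
  have h3 : (0 : ℝ) < n.factorial := mod_cast n.factorial_pos
  simp only [hypCoeff, norm_div, norm_mul, Complex.norm_natCast]
  gcongr

/-! ### Bailey's evaluation at 1/2. -/

/-- `₂F₁(a, 1 - a; c; 1 / 2)`. -/
noncomputable def hypHalf (a c : ℂ) : ℂ := powSum (hypCoeff a c) (1 / 2)

theorem norm_half_lt_one : ‖(1 / 2 : ℂ)‖ < 1 := by norm_num

theorem DiscSummable.tendsto_zero {u : ℕ → ℂ} (hu : DiscSummable u) {z : ℂ} (hz : ‖z‖ < 1) :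
    Tendsto (fun n => u n * z ^ n) atTop (𝓝 0) := (hu.summable hz).tendsto_atTop_zero

theorem HasSum.eq_of_telescoping {f G : ℕ → ℂ} {s l : ℂ} (hf : HasSum f s)
    (h : ∀ n, f n = G (n + 1) - G n) (hG : Tendsto G atTop (𝓝 l)) : s = l - G 0 := by
  refine tendsto_nhds_unique hf.tendsto_sum_nat ?_
  simp_rw [h, Finset.sum_range_sub]
  exact hG.sub_const _

/-- The difference of the two series telescopes at z = 1/2. Iterating the relation c ↦ c + 2
produces Bailey's formula. -/
theorem hypHalf_add_two (a : ℂ) {c : ℂ} (hc : 0 < c.re) :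
    c * (c + 1) * hypHalf a c = (c + a) * (c + 1 - a) * hypHalf a (c + 2) := by
  have hc2 : 0 < (c + 2).re := by simp; linarith
  have hu := discSummable_hypCoeff a hc
  have hsum := ((hu.hasSum norm_half_lt_one).mul_left (c * (c + 1))).sub
    (((discSummable_hypCoeff a hc2).hasSum norm_half_lt_one).mul_left ((c + a) * (c + 1 - a)))
  -- The telescoping certificate: the n-th term of the difference is G(n + 1) - G(n) for this G,
  -- which is 0 at n = 0 and tends to 0.
  have hlim : Tendsto (fun n : ℕ => -2 * c * (c + 1) * (n / (c + n)) *
      (hypCoeff a c n * (1 / 2) ^ n)) atTop (𝓝 0) := by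
    have h := tendsto_add_natCast_div 0 c
    simp only [zero_add] at h
    simpa using (h.const_mul (-2 * c * (c + 1))).mul (hu.tendsto_zero norm_half_lt_one)
  have := hsum.eq_of_telescoping (fun n => ?_) hlim
  · simpa [hypHalf, sub_eq_zero] using this
  have h0 : c ≠ 0 := by simpa using add_natCast_ne_zero_of_re_pos hc 0
  have h0' : c + 1 ≠ 0 := by simpa using add_natCast_ne_zero_of_re_pos hc 1
  have h1 := add_natCast_ne_zero_of_re_pos hc n
  have h2 : c + n + 1 ≠ 0 := by simpa [add_assoc] using add_natCast_ne_zero_of_re_pos hc (n + 1)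
  have h3 : (n : ℂ) + 1 ≠ 0 := n.cast_add_one_ne_zero
  have h4 : hypCoeff a (c + 2) n =
      c * (c + 1) / ((c + n) * (c + n + 1)) * hypCoeff a c n := by
    have h5 : poch (c + 2) n = poch c n * (c + n) * (c + n + 1) / (c * (c + 1)) := by
      rw [← poch_add_two]; field_simp
    have h6 := poch_ne_zero_of_re_pos hc n
    have h7 : (n.factorial : ℂ) ≠ 0 := mod_cast n.factorial_ne_zero
    rw [hypCoeff, hypCoeff, h5]
    field_simp
  rw [h4, hypCoeff_succ a hc, pow_succ]
  have h2' : c + (n + 1) ≠ 0 := by rwa [← add_assoc]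
  push_cast
  field_simp
  ring

/-- Dominated convergence with the coefficients at c = 1/2 as majorant: the constant term is 1, and
every other term is O(1/N). -/
theorem tendsto_hypHalf_add (a : ℂ) {c : ℂ} (hc : 1 / 2 ≤ c.re) :
    Tendsto (fun N : ℕ => hypHalf a (c + 2 * N)) atTop (𝓝 1) := by
  have hre (N : ℕ) : 1 / 2 ≤ (c + 2 * N).re := by
    have : (0 : ℝ) ≤ N := N.cast_nonneg
    simp; linarith
  have key := tendsto_tsum_of_dominated_convergence (𝓕 := atTop)
    (f := fun (N : ℕ) (n : ℕ) => hypCoeff a (c + 2 * N) n * (1 / 2 : ℂ) ^ n)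
    (g := fun n : ℕ => if n = 0 then (1 : ℂ) else 0)
    (bound := fun n => ‖hypCoeff a (1 / 2) n‖ * (1 / 2 : ℝ) ^ n)
    (discSummable_hypCoeff a (c := 1 / 2) (by norm_num) (1 / 2) (by norm_num) (by norm_num))
    (fun n => ?_) (.of_forall fun N n => ?_)
  · simpa [hypHalf, powSum] using key
  · rcases n with _ | n
    · simp [hypCoeff_zero]
    · simp only [Nat.add_eq_zero_iff, one_ne_zero, and_false, if_false]
      have h0 : Tendsto (fun N : ℕ => hypCoeff a (c + 2 * N) (n + 1)) atTop (𝓝 0) := by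
        set M := ‖(a + n) * (1 - a + n) / (n + 1)‖ * ‖hypCoeff a (1 / 2) n‖
        refine squeeze_zero_norm (a := fun N : ℕ => M * 2 * (1 / ((N : ℝ) + 1))) (fun N => ?_) ?_
        · have hpos : 0 < (c + 2 * N).re := by linarith [hre N]
          have hle := norm_hypCoeff_le a (hre N) n
          have hden : ((N : ℝ) + 1) / 2 ≤ ‖c + 2 * N + n‖ := by
            refine le_trans ?_ (Complex.re_le_norm _)
            have h1 : (0 : ℝ) ≤ N := N.cast_nonneg
            have h2 : (0 : ℝ) ≤ n := n.cast_nonneg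
            simp
            linarith
          have hN : 0 < ((N : ℝ) + 1) / 2 := by positivity
          rw [hypCoeff_succ a hpos, ← div_div, norm_mul, norm_div]
          calc ‖(a + n) * (1 - a + n) / (n + 1)‖ / ‖c + 2 * N + n‖ * ‖hypCoeff a (c + 2 * N) n‖
              ≤ ‖(a + n) * (1 - a + n) / (n + 1)‖ / (((N : ℝ) + 1) / 2) *
                ‖hypCoeff a (1 / 2) n‖ := by gcongr
            _ = M * 2 * (1 / ((N : ℝ) + 1)) := by simp only [M]; field_simp
        · simpa using (tendsto_one_div_add_atTop_nhds_zero_nat (𝕜 := ℝ)).const_mul (M * 2)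
      simpa using h0.mul_const ((1 / 2 : ℂ) ^ (n + 1))
  · rw [norm_mul, norm_pow]
    have := norm_hypCoeff_le a (hre N) n
    norm_num
    gcongr

/-- The N-fold iterate of `hypHalf_add_two`, with a factor 1/4 put on both sides of each step to
halve the parameters. The product form avoids dividing by factors that may vanish. -/
theorem hypHalf_mul_poch (a : ℂ) {c : ℂ} (hc : 0 < c.re) (N : ℕ) :
    hypHalf a c * (poch (c / 2) N * poch ((c + 1) / 2) N) =
      poch ((c + a) / 2) N * poch ((c + 1 - a) / 2) N * hypHalf a (c + 2 * N) := by
  induction N with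
  | zero => simp
  | succ N ih =>
    have hre : 0 < (c + 2 * N).re := by
      have : (0 : ℝ) ≤ N := N.cast_nonneg
      simp; linarith
    have h := hypHalf_add_two a hre
    have he : c + 2 * ((N + 1 : ℕ) : ℂ) = c + 2 * N + 2 := by push_cast; ring
    rw [he]
    simp only [poch_succ]
    linear_combination (c / 2 + N) * ((c + 1) / 2 + N) * ih +
      poch ((c + a) / 2) N * poch ((c + 1 - a) / 2) N / 4 * h

theorem GammaSeq_eq (s : ℂ) (n : ℕ) :
    Complex.GammaSeq s n = (n : ℂ) ^ s * n.factorial / poch s (n + 1) := by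
  rw [Complex.GammaSeq, poch_eq_prod]

/-- `Complex.Gamma` has the value 0 exactly at the poles of Γ, so `Gamma s ≠ 0` serves throughout as
the condition that s is not a pole. -/
theorem poch_ne_zero_of_Gamma_ne_zero {s : ℂ} (hs : Complex.Gamma s ≠ 0) (n : ℕ) :
    poch s n ≠ 0 := by
  rw [poch_eq_prod, Finset.prod_ne_zero_iff]
  intro j _ h
  exact hs ((Complex.Gamma_eq_zero_iff s).2 ⟨j, eq_neg_of_add_eq_zero_left h⟩)

/-- Bailey's evaluation of `₂F₁(a, 1 - a; c; 1 / 2)`. -/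
theorem hypHalf_mul_Gamma (a : ℂ) {c : ℂ} (hc : 1 / 2 ≤ c.re)
    (h1 : Complex.Gamma ((c + a) / 2) ≠ 0) (h2 : Complex.Gamma ((c + 1 - a) / 2) ≠ 0) :
    hypHalf a c * (Complex.Gamma ((c + a) / 2) * Complex.Gamma ((c + 1 - a) / 2)) =
      Complex.Gamma (c / 2) * Complex.Gamma ((c + 1) / 2) := by
  have hc0 : 0 < c.re := by linarith
  have hl := ((Complex.GammaSeq_tendsto_Gamma ((c + a) / 2)).mul
    (Complex.GammaSeq_tendsto_Gamma ((c + 1 - a) / 2))).const_mul (hypHalf a c)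
  have hr := ((Complex.GammaSeq_tendsto_Gamma (c / 2)).mul
    (Complex.GammaSeq_tendsto_Gamma ((c + 1) / 2))).mul
    ((tendsto_add_atTop_iff_nat 1).2 (tendsto_hypHalf_add a hc))
  rw [mul_one] at hr
  refine tendsto_nhds_unique (hl.congr' ?_) hr
  filter_upwards [eventually_ne_atTop 0] with n hn
  have hn' : (n : ℂ) ≠ 0 := mod_cast hn
  -- Index n + 1, because the denominator of `GammaSeq s n` has n + 1 factors.
  have h := hypHalf_mul_poch a hc0 (n + 1)
  have p1 := poch_ne_zero_of_Gamma_ne_zero h1 (n + 1)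
  have p2 := poch_ne_zero_of_Gamma_ne_zero h2 (n + 1)
  have p3 : poch (c / 2) (n + 1) ≠ 0 := poch_ne_zero_of_re_pos (by simpa using hc0) _
  have p4 : poch ((c + 1) / 2) (n + 1) ≠ 0 :=
    poch_ne_zero_of_re_pos (by simp; linarith) _
  -- The powers of n in Euler's limit cancel because both pairs of Gamma arguments have the sum c +
  -- 1/2.
  have hpow : (n : ℂ) ^ ((c + a) / 2) * (n : ℂ) ^ ((c + 1 - a) / 2) =
      (n : ℂ) ^ (c / 2) * (n : ℂ) ^ ((c + 1) / 2) := by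
    rw [← Complex.cpow_add _ _ hn', ← Complex.cpow_add _ _ hn']
    congr 1; ring
  simp only [GammaSeq_eq]
  have e1 : ∀ x y f p q : ℂ, x * f / p * (y * f / q) = x * y * f ^ 2 / (p * q) := by
    intro x y f p q; rw [div_mul_div_comm]; ring
  rw [e1, e1, hpow, mul_div_assoc', div_mul_eq_mul_div,
    div_eq_div_iff (mul_ne_zero p1 p2) (mul_ne_zero p3 p4)]
  linear_combination (n : ℂ) ^ (c / 2) * (n : ℂ) ^ ((c + 1) / 2) * (n.factorial : ℂ) ^ 2 * h

/-! ### The harmonic twist at 1/2, by differentiation in the parameter c. -/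

/-- The coefficients of the harmonic-number twist of `₂F₁(a, 1 - a; 1; z)`. -/
noncomputable def harmCoeff (a : ℂ) (n : ℕ) : ℂ := hypCoeff a 1 n * ((harmonic n : ℚ) : ℂ)

theorem discSummable_harmCoeff (a : ℂ) : DiscSummable (harmCoeff a) := by
  refine (discSummable_hypCoeff a (c := 1) (by simp)).natCast_mul.of_le fun n => ?_
  have h : ‖((harmonic n : ℚ) : ℂ)‖ ≤ n := by
    simp only [harmonic, Rat.cast_sum]
    refine (norm_sum_le_of_le (n := fun _ => (1 : ℝ)) _ fun i _ => ?_).trans (by simp)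
    push_cast
    rw [norm_inv, inv_le_one_iff₀]
    right
    have : ((i : ℂ) + 1) = ((i + 1 : ℕ) : ℂ) := by push_cast; ring
    rw [this, Complex.norm_natCast]
    simp
  rw [harmCoeff, norm_mul, norm_mul, Complex.norm_natCast, mul_comm]
  gcongr

theorem hasDerivAt_poch (c : ℂ) (n : ℕ) :
    HasDerivAt (fun c => poch c n) (deriv (fun c => poch c n) c) c := by
  refine DifferentiableAt.hasDerivAt ?_
  simp only [poch_eq_prod]
  fun_prop

theorem hasDerivAt_poch_one (n : ℕ) :
    HasDerivAt (fun c => poch c n) (n.factorial * ((harmonic n : ℚ) : ℂ)) 1 := by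
  induction n with
  | zero => simpa using hasDerivAt_const (1 : ℂ) (1 : ℂ)
  | succ n ih =>
    simp only [poch_succ]
    refine (ih.mul ((hasDerivAt_id (1 : ℂ)).add_const (n : ℂ))).congr_deriv ?_
    have h : (n : ℂ) + 1 ≠ 0 := n.cast_add_one_ne_zero
    rw [harmonic_succ, Nat.factorial_succ, poch_one]
    push_cast
    simp only [id]
    field_simp
    ring

/-- Termwise differentiation in c: the derivative of 1/(c)_n at c = 1 is -H_n/n!. Holomorphy and the
uniform majorant on Re c > 1/2 justify it. -/
theorem hasDerivAt_hypHalf_one (a : ℂ) :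
    HasDerivAt (hypHalf a) (-powSum (harmCoeff a) (1 / 2)) 1 := by
  have hU : IsOpen {c : ℂ | 1 / 2 < c.re} := isOpen_lt continuous_const Complex.continuous_re
  have h1 : (1 : ℂ) ∈ {c : ℂ | 1 / 2 < c.re} := by norm_num
  have hs := discSummable_hypCoeff a (c := 1 / 2) (by norm_num) (1 / 2) (by norm_num) (by norm_num)
  have hterm (n : ℕ) (c : ℂ) (hc : 0 < c.re) (p : ℂ) (hp : HasDerivAt (fun c => poch c n) p c) :
      HasDerivAt (fun c => hypCoeff a c n * (1 / 2 : ℂ) ^ n)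
        (-(poch a n * poch (1 - a) n / (n.factorial * poch c n ^ 2)) * p * (1 / 2) ^ n) c := by
    have h0 := poch_ne_zero_of_re_pos hc n
    have h3 : (n.factorial : ℂ) ≠ 0 := mod_cast n.factorial_ne_zero
    have := ((hp.const_mul (n.factorial : ℂ)).fun_inv (mul_ne_zero h3 h0)).const_mul
      (poch a n * poch (1 - a) n)
    refine (this.mul_const ((1 / 2 : ℂ) ^ n)).congr_deriv ?_
    field_simp
  have hdiff (n : ℕ) : DifferentiableOn ℂ (fun c => hypCoeff a c n * (1 / 2 : ℂ) ^ n)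
      {c : ℂ | 1 / 2 < c.re} := fun c hc =>
    (hterm n c (by have : 1 / 2 < c.re := hc; linarith) _
      (hasDerivAt_poch c n)).differentiableAt.differentiableWithinAt
  have hle (n : ℕ) (c : ℂ) (hc : c ∈ {c : ℂ | 1 / 2 < c.re}) :
      ‖hypCoeff a c n * (1 / 2 : ℂ) ^ n‖ ≤ ‖hypCoeff a (1 / 2) n‖ * (1 / 2 : ℝ) ^ n := by
    rw [norm_mul, norm_pow]
    have := norm_hypCoeff_le a (le_of_lt hc) n
    norm_num
    gcongr
  have hd : DifferentiableAt ℂ (hypHalf a) 1 :=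
    (Complex.differentiableOn_tsum_of_summable_norm hs hdiff hU hle).differentiableAt
      (hU.mem_nhds h1)
  have hsum : HasSum _ (deriv (hypHalf a) 1) :=
    Complex.hasSum_deriv_of_summable_norm hs hdiff hU hle h1
  have hg := ((discSummable_harmCoeff a).hasSum norm_half_lt_one).neg
  have he : deriv (hypHalf a) 1 = -powSum (harmCoeff a) (1 / 2) := by
    refine hsum.unique (hg.congr_fun fun n => ?_)
    rw [(hterm n 1 (by simp) _ (hasDerivAt_poch_one n)).deriv, harmCoeff, hypCoeff, poch_one]
    have h3 : (n.factorial : ℂ) ≠ 0 := mod_cast n.factorial_ne_zero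
    field_simp
  rw [← he]
  exact hd.hasDerivAt

theorem Gamma_ne_zero_of_two_mul_ne_int {s : ℂ} (h : ∀ k : ℤ, 2 * s ≠ k) :
    Complex.Gamma s ≠ 0 := by
  rw [Ne, Complex.Gamma_eq_zero_iff]
  rintro ⟨m, hm⟩
  exact h (-2 * m) (by rw [hm]; push_cast; ring)

theorem hasDerivAt_Gamma_div_two {b : ℂ} (hs : Complex.Gamma ((1 + b) / 2) ≠ 0) :
    HasDerivAt (fun c => Complex.Gamma ((c + b) / 2))
      (Complex.digamma ((1 + b) / 2) * Complex.Gamma ((1 + b) / 2) / 2) 1 := by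
  have hd : DifferentiableAt ℂ Complex.Gamma ((1 + b) / 2) :=
    Complex.differentiableAt_Gamma _ fun m hm => hs ((Complex.Gamma_eq_zero_iff _).2 ⟨m, hm⟩)
  have hl : HasDerivAt (fun c : ℂ => (c + b) / 2) (1 / 2) 1 :=
    ((hasDerivAt_id (1 : ℂ)).add_const b).div_const 2
  refine (HasDerivAt.comp (1 : ℂ) hd.hasDerivAt hl).congr_deriv ?_
  rw [Complex.digamma_def, logDeriv_apply]
  field_simp

theorem Gamma_half_add_ne_zero {a : ℂ} (ha : ∀ k : ℤ, a ≠ k) (j : ℤ) :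
    Complex.Gamma ((j + a) / 2) ≠ 0 :=
  Gamma_ne_zero_of_two_mul_ne_int fun k h => ha (k - j) (by push_cast; linear_combination h)

theorem Gamma_half_sub_ne_zero {a : ℂ} (ha : ∀ k : ℤ, a ≠ k) (j : ℤ) :
    Complex.Gamma ((j - a) / 2) ≠ 0 :=
  Gamma_ne_zero_of_two_mul_ne_int fun k h => ha (j - k) (by push_cast; linear_combination -h)

/-- Bailey's formula holds for all c near 1, so the derivatives of its two sides at c = 1 agree.
Dividing by the Gamma product turns the derivatives of Γ into digamma values. -/
theorem powSum_harmCoeff_half {a : ℂ} (ha : ∀ k : ℤ, a ≠ k) :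
    powSum (harmCoeff a) (1 / 2) = 1 / 2 * (Complex.digamma (1 - a / 2)
      + Complex.digamma ((a + 1) / 2) - Complex.digamma 1 - Complex.digamma (1 / 2))
      * hypHalf a 1 := by
  have g1 : Complex.Gamma ((1 + a) / 2) ≠ 0 := mod_cast Gamma_half_add_ne_zero ha 1
  have g2 : Complex.Gamma ((1 + (1 - a)) / 2) ≠ 0 := by
    have := Gamma_half_sub_ne_zero ha 2
    convert this using 2
    push_cast; ring
  have g3 : Complex.Gamma ((1 + 0) / 2) ≠ 0 := Complex.Gamma_ne_zero_of_re_pos (by norm_num)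
  have g4 : Complex.Gamma ((1 + 1) / 2) ≠ 0 := Complex.Gamma_ne_zero_of_re_pos (by norm_num)
  have d1 := hasDerivAt_Gamma_div_two g1
  have d2 := hasDerivAt_Gamma_div_two g2
  have hl := (hasDerivAt_hypHalf_one a).fun_mul (d1.fun_mul d2)
  have hr := (hasDerivAt_Gamma_div_two g3).fun_mul (hasDerivAt_Gamma_div_two g4)
  have hev : (fun c => hypHalf a c *
      (Complex.Gamma ((c + a) / 2) * Complex.Gamma ((c + (1 - a)) / 2))) =ᶠ[𝓝 1]
      fun c => Complex.Gamma ((c + 0) / 2) * Complex.Gamma ((c + 1) / 2) := by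
    have hU : IsOpen {c : ℂ | 1 / 2 < c.re} := isOpen_lt continuous_const Complex.continuous_re
    filter_upwards [hU.mem_nhds (show (1 : ℂ) ∈ {c : ℂ | 1 / 2 < c.re} by norm_num),
      d1.continuousAt.eventually_ne g1, d2.continuousAt.eventually_ne g2] with c hc e1 e2
    have hc : 1 / 2 < c.re := hc
    rw [← add_sub_assoc] at e2 ⊢
    rw [add_zero]
    exact hypHalf_mul_Gamma a hc.le e1 e2
  have hd := hl.unique (hr.congr_of_eventuallyEq hev)
  have hv := hev.self_of_nhds
  have e2 : (1 + (1 - a)) / 2 = 1 - a / 2 := by ring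
  have e4 : ((1 : ℂ) + 1) / 2 = 1 := by norm_num
  rw [add_comm 1 a] at g1
  simp only [e2, e4, add_zero, add_comm 1 a] at hd hv g2
  rw [← mul_left_inj' (mul_ne_zero g1 g2)]
  linear_combination -hd + (1 / 2) * (Complex.digamma 1 + Complex.digamma (1 / 2)) * hv

/-! ### The product F(1/2)F'(1/2). -/

/-- In effect Euler's transformation F'(z) = a(1 - a)(1 - z)⁻¹ ₂F₁(a, 1 - a; 2; z) at z = 1/2,
obtained here by telescoping. It makes F'(1/2) accessible to Bailey's formula with c = 2. -/
theorem powSum_deriv_hypCoeff_half (a : ℂ) :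
    powSum (derivCoeff (hypCoeff a 1)) (1 / 2) = 2 * a * (1 - a) * hypHalf a 2 := by
  have hu := discSummable_hypCoeff a (c := 1) (by simp)
  have hu2 := discSummable_hypCoeff a (c := 2) (by simp)
  have hsum := (hu.deriv.hasSum norm_half_lt_one).sub
    ((hu2.hasSum norm_half_lt_one).mul_left (2 * a * (1 - a)))
  -- The certificate is G(n) = -2n t_n 2⁻ⁿ, where t_n is the n-th coefficient of F.
  have hlim := (hu.natCast_mul.tendsto_zero norm_half_lt_one).const_mul (-2)
  have := hsum.eq_of_telescoping (fun n => ?_) hlim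
  · simpa [hypHalf, sub_eq_zero] using this
  have h3 : (n : ℂ) + 1 ≠ 0 := n.cast_add_one_ne_zero
  have h7 : (n.factorial : ℂ) ≠ 0 := mod_cast n.factorial_ne_zero
  have h4 : hypCoeff a 2 n = hypCoeff a 1 n / (n + 1) := by
    rw [hypCoeff, hypCoeff, poch_two, poch_one]
    field_simp
  have h5 : (1 : ℂ) + n ≠ 0 := by rwa [add_comm]
  rw [h4, derivCoeff, hypCoeff_succ a (by simp), pow_succ]
  push_cast
  field_simp
  ring

theorem sin_pi_mul_ne_zero_of_ne_intCast {a : ℂ} (ha : ∀ k : ℤ, a ≠ k) :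
    Complex.sin (Real.pi * a) ≠ 0 :=
  sin_pi_mul_ne_zero fun ⟨k, hk⟩ => ha k hk.symm

/-- Multiplying Bailey's formula for c = 1 and c = 2 leaves Γ at a/2, 1 - a/2, (1 + a)/2 and (1 -
a)/2. These form two reflection pairs, whose sines combine by the double-angle formula. -/
theorem hypHalf_mul_deriv {a : ℂ} (ha : ∀ k : ℤ, a ≠ k) :
    hypHalf a 1 * powSum (derivCoeff (hypCoeff a 1)) (1 / 2) =
      2 * (Complex.sin (Real.pi * a) / Real.pi) := by
  have hpi : (Real.pi : ℂ) ≠ 0 := mod_cast Real.pi_ne_zero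
  have g (j : ℤ) := Gamma_half_add_ne_zero ha j
  have g' (j : ℤ) := Gamma_half_sub_ne_zero ha j
  have g0 : Complex.Gamma (a / 2) ≠ 0 := by simpa using g 0
  have g1 : Complex.Gamma ((1 + a) / 2) ≠ 0 := mod_cast g 1
  have g1' : Complex.Gamma ((1 - a) / 2) ≠ 0 := mod_cast g' 1
  have g2' : Complex.Gamma (1 - a / 2) ≠ 0 := by
    have := g' 2
    push_cast at this
    rwa [sub_div, div_self two_ne_zero] at this
  have ha0 : a / 2 ≠ 0 := div_ne_zero (by simpa using ha 0) two_ne_zero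
  have ha1 : (1 - a) / 2 ≠ 0 :=
    div_ne_zero (sub_ne_zero.2 (by simpa using (ha 1).symm)) two_ne_zero
  have f2 : Complex.Gamma ((2 + a) / 2) = a / 2 * Complex.Gamma (a / 2) := by
    rw [← Complex.Gamma_add_one _ ha0]; congr 1; ring
  have f3 : Complex.Gamma ((2 + 1 - a) / 2) = (1 - a) / 2 * Complex.Gamma ((1 - a) / 2) := by
    rw [← Complex.Gamma_add_one _ ha1]; congr 1; ring
  have f4 : Complex.Gamma ((2 + 1) / 2) = 1 / 2 * Complex.Gamma (1 / 2) := by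
    rw [← Complex.Gamma_add_one _ (by norm_num)]; congr 1; norm_num
  have hsq : Complex.Gamma (1 / 2) * Complex.Gamma (1 / 2) = Real.pi := by
    have := Complex.Gamma_mul_Gamma_one_sub (1 / 2)
    norm_num [mul_one_div] at this
    simpa using this
  have e1 : (1 + 1 - a) / 2 = 1 - a / 2 := by ring
  have e2 : ((1 : ℂ) + 1) / 2 = 1 := by norm_num
  have hT1 := hypHalf_mul_Gamma a (c := 1) (by norm_num) g1 (by rwa [e1])
  have hT2 := hypHalf_mul_Gamma a (c := 2) (by norm_num)
    (by rw [f2]; exact mul_ne_zero ha0 g0) (by rw [f3]; exact mul_ne_zero ha1 g1')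
  have e3 : (2 : ℂ) / 2 = 1 := by norm_num
  rw [e1, e2, Complex.Gamma_one, mul_one] at hT1
  rw [f2, f3, f4, e3, Complex.Gamma_one, one_mul] at hT2
  have r1 := Complex.Gamma_mul_Gamma_one_sub (a / 2)
  have r2 := Complex.Gamma_mul_Gamma_one_sub ((1 + a) / 2)
  have e4 : 1 - (1 + a) / 2 = (1 - a) / 2 := by ring
  have e5 : Real.pi * ((1 + a) / 2) = Real.pi * a / 2 + Real.pi / 2 := by ring
  have e6 : Real.pi * (a / 2) = Real.pi * a / 2 := by ring
  have hsin : Complex.sin (Real.pi * a) =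
      2 * Complex.sin (Real.pi * a / 2) * Complex.cos (Real.pi * a / 2) := by
    rw [← Complex.sin_two_mul]; congr 1; ring
  have hne := sin_pi_mul_ne_zero_of_ne_intCast ha
  rw [hsin] at hne
  have hs := right_ne_zero_of_mul (left_ne_zero_of_mul hne)
  have hc := right_ne_zero_of_mul hne
  rw [e6, eq_div_iff hs] at r1
  rw [e4, e5, Complex.sin_add_pi_div_two, eq_div_iff hc] at r2
  rw [powSum_deriv_hypCoeff_half, hsin]
  have hprod : Complex.Gamma (a / 2) * Complex.Gamma (1 - a / 2) *
      (Complex.Gamma ((1 + a) / 2) * Complex.Gamma ((1 - a) / 2)) ≠ 0 :=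
    mul_ne_zero (mul_ne_zero g0 g2') (mul_ne_zero g1 g1')
  have hT : hypHalf a 1 * (2 * a * (1 - a) * hypHalf a 2) *
      (Complex.Gamma (a / 2) * Complex.Gamma (1 - a / 2) *
      (Complex.Gamma ((1 + a) / 2) * Complex.Gamma ((1 - a) / 2))) = 4 * Real.pi := by
    linear_combination 8 * hypHalf a 2 * (a / 2) * Complex.Gamma (a / 2) * ((1 - a) / 2) *
      Complex.Gamma ((1 - a) / 2) * hT1 + 8 * Complex.Gamma (1 / 2) * hT2 + 4 * hsq
  have hR : Complex.Gamma (a / 2) * Complex.Gamma (1 - a / 2) *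
      (Complex.Gamma ((1 + a) / 2) * Complex.Gamma ((1 - a) / 2)) *
      (Complex.sin (Real.pi * a / 2) * Complex.cos (Real.pi * a / 2)) = Real.pi ^ 2 := by
    linear_combination Complex.Gamma ((1 + a) / 2) * Complex.Gamma ((1 - a) / 2) *
      Complex.cos (Real.pi * a / 2) * r1 + Real.pi * r2
  refine mul_right_cancel₀ hprod (hT.trans ?_)
  rw [mul_div_assoc', div_mul_eq_mul_div, eq_div_iff hpi]
  linear_combination -4 * hR

/-! ### The differential equations and the Wronskian at 0. -/

theorem discSummable_hypCoeff_one (a : ℂ) : DiscSummable (hypCoeff a 1) :=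
  discSummable_hypCoeff a (by simp)

theorem hypCoeff_one_succ (a : ℂ) (n : ℕ) :
    ((n : ℂ) + 1) ^ 2 * hypCoeff a 1 (n + 1) =
      (n * (n + 1) + a * (1 - a)) * hypCoeff a 1 n := by
  have h3 : (n : ℂ) + 1 ≠ 0 := n.cast_add_one_ne_zero
  rw [hypCoeff_succ a (by simp), add_comm (1 : ℂ) n]
  field_simp
  ring

theorem hasDerivAt_hyp_flux (a : ℂ) {z : ℂ} (hz : ‖z‖ < 1) :
    HasDerivAt (fun w => w * (1 - w) * powSum (derivCoeff (hypCoeff a 1)) w)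
      (a * (1 - a) * powSum (hypCoeff a 1) z) z := by
  refine ((discSummable_hypCoeff_one a).hasDerivAt_mul_powSum_deriv hz).congr_deriv ?_
  rw [powSum, powSum, ← tsum_mul_left]
  refine tsum_congr fun n => ?_
  rw [hypCoeff_one_succ]
  ring

/-- The recurrence for F multiplied by H_n, plus a correction from H_{n+1} - H_n = 1/(n + 1) whose
series is F'. -/
theorem hasDerivAt_harm_flux (a : ℂ) {z : ℂ} (hz : ‖z‖ < 1) :
    HasDerivAt (fun w => w * (1 - w) * powSum (derivCoeff (harmCoeff a)) w)
      (a * (1 - a) * powSum (harmCoeff a) z + powSum (derivCoeff (hypCoeff a 1)) z) z := by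
  refine ((discSummable_harmCoeff a).hasDerivAt_mul_powSum_deriv hz).congr_deriv ?_
  have h := (((discSummable_harmCoeff a).hasSum hz).mul_left (a * (1 - a))).add
    ((discSummable_hypCoeff_one a).deriv.hasSum hz)
  rw [← h.tsum_eq]
  refine tsum_congr fun n => ?_
  have h3 : (n : ℂ) + 1 ≠ 0 := n.cast_add_one_ne_zero
  have h4 := hypCoeff_one_succ a n
  have h5 : ((harmonic (n + 1) : ℚ) : ℂ) = ((harmonic n : ℚ) : ℂ) + ((n : ℂ) + 1)⁻¹ := by
    rw [harmonic_succ]; push_cast; rfl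
  simp only [harmCoeff, derivCoeff, h5]
  have h6 : ((n : ℂ) + 1) ^ 2 * (hypCoeff a 1 (n + 1) *
      (((harmonic n : ℚ) : ℂ) + ((n : ℂ) + 1)⁻¹)) =
      ((n : ℂ) + 1) ^ 2 * hypCoeff a 1 (n + 1) * ((harmonic n : ℚ) : ℂ) +
        (n + 1) * hypCoeff a 1 (n + 1) := by field_simp
  rw [h6, h4]
  ring

theorem powSum_zero (u : ℕ → ℂ) : powSum u 0 = u 0 := by
  rw [powSum, tsum_eq_single 0 (fun n hn => by simp [hn])]
  simp

theorem eq_of_hasDerivAt_zero {U : Set ℂ} (hU : IsOpen U) (hc : Convex ℝ U) {f : ℂ → ℂ}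
    (hf : ∀ z ∈ U, HasDerivAt f 0 z) {x y : ℂ} (hx : x ∈ U) (hy : y ∈ U) : f x = f y :=
  hU.is_const_of_deriv_eq_zero hc.isPreconnected
    (fun z hz => (hf z hz).differentiableAt.differentiableWithinAt) (fun z hz => (hf z hz).deriv)
    hx hy

/-- This is z(1 - z) times the Wronskian of F and K. The logarithms cancel in it, so it is
holomorphic on the whole disc and its constant value can be read off at 0. -/
theorem hyp_harm_wronskian (a : ℂ) {z : ℂ} (hz : ‖z‖ < 1) :
    2 * (powSum (hypCoeff a 1) z * (z * (1 - z) * powSum (derivCoeff (harmCoeff a)) z)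
      - z * (1 - z) * powSum (derivCoeff (hypCoeff a 1)) z * powSum (harmCoeff a) z)
      - powSum (hypCoeff a 1) z ^ 2 = -1 := by
  have hd (w : ℂ) (hw : w ∈ Metric.ball (0 : ℂ) 1) : HasDerivAt (fun z =>
      2 * (powSum (hypCoeff a 1) z * (z * (1 - z) * powSum (derivCoeff (harmCoeff a)) z)
        - z * (1 - z) * powSum (derivCoeff (hypCoeff a 1)) z * powSum (harmCoeff a) z)
        - powSum (hypCoeff a 1) z ^ 2) 0 w := by
    rw [mem_ball_zero_iff] at hw
    have hF := (discSummable_hypCoeff_one a).hasDerivAt hw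
    have hg := (discSummable_harmCoeff a).hasDerivAt hw
    refine ((((hF.fun_mul (hasDerivAt_harm_flux a hw)).fun_sub
      ((hasDerivAt_hyp_flux a hw).fun_mul hg)).const_mul 2).fun_sub (hF.fun_pow 2)).congr_deriv ?_
    push_cast
    ring
  have := eq_of_hasDerivAt_zero Metric.isOpen_ball (convex_ball (0 : ℂ) 1) hd
    (mem_ball_zero_iff.2 hz) (Metric.mem_ball_self one_pos)
  rw [this]
  simp [powSum_zero, hypCoeff_zero]

/-! ### The logarithmic solution and the connection formula. -/

/-- The logarithmic companion of `₂F₁(a, 1 - a; 1; z)`. -/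
noncomputable def hypLog (a z : ℂ) : ℂ :=
  2 * powSum (harmCoeff a) z + Complex.log ((1 - z) / z) * powSum (hypCoeff a 1) z

/-- If (1 - z)/z = r ≤ 0, then z = 1/(1 + r) with |1 + r| > 1. This forces 1 + r < 0, so z would lie
on the cut. -/
theorem one_sub_div_mem_slitPlane {z : ℂ} (hz : ‖z‖ < 1) (hs : z ∈ Complex.slitPlane) :
    (1 - z) / z ∈ Complex.slitPlane := by
  have hz0 := Complex.slitPlane_ne_zero hs
  rw [Complex.mem_slitPlane_iff_not_le_zero] at hs ⊢
  intro h
  obtain ⟨h1, h2⟩ := Complex.le_def.1 h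
  simp only [Complex.zero_re, Complex.zero_im] at h1 h2
  set r := ((1 - z) / z).re
  have hq : (1 - z) / z = (r : ℂ) := Complex.ext rfl (by simpa using h2)
  rw [div_eq_iff hz0] at hq
  have hm : ((1 + r : ℝ) : ℂ) * z = 1 := by push_cast; linear_combination -hq
  have hr : (1 + r) ≠ 0 := fun h0 => by rw [h0] at hm; simp at hm
  have hzr : z = (((1 + r)⁻¹ : ℝ) : ℂ) := by
    rw [Complex.ofReal_inv]; exact eq_inv_of_mul_eq_one_right hm
  rw [hzr, Complex.norm_real, norm_inv, Real.norm_eq_abs] at hz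
  have h3 : 1 < |1 + r| := (inv_lt_one₀ (abs_pos.2 hr)).1 hz
  have h4 : 1 + r < 0 := by
    by_contra hcon
    rw [abs_of_nonneg (not_lt.1 hcon)] at h3
    linarith
  refine hs ?_
  rw [hzr]
  exact_mod_cast (inv_lt_zero.2 h4).le

theorem hasDerivAt_log_one_sub_div {z : ℂ} (hz : ‖z‖ < 1) (hs : z ∈ Complex.slitPlane) :
    HasDerivAt (fun w => Complex.log ((1 - w) / w)) (-(z * (1 - z))⁻¹) z := by
  have hz0 := Complex.slitPlane_ne_zero hs
  have hz1 : 1 - z ≠ 0 := fun h => by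
    rw [← sub_eq_zero.1 h, norm_one] at hz
    exact lt_irrefl _ hz
  refine ((((hasDerivAt_id z).const_sub 1).fun_div (hasDerivAt_id z) hz0).clog
    (one_sub_div_mem_slitPlane hz hs)).congr_deriv ?_
  simp only [id]
  field_simp
  ring

theorem differentiableAt_hypLog (a : ℂ) {z : ℂ} (hz : ‖z‖ < 1) (hs : z ∈ Complex.slitPlane) :
    DifferentiableAt ℂ (hypLog a) z :=
  (((discSummable_harmCoeff a).hasDerivAt hz).differentiableAt.const_mul 2).fun_add
    ((hasDerivAt_log_one_sub_div hz hs).differentiableAt.fun_mul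
      ((discSummable_hypCoeff_one a).hasDerivAt hz).differentiableAt)

theorem mem_slitPlane_of_norm_one_sub_lt {z : ℂ} (hz : ‖1 - z‖ < 1) : z ∈ Complex.slitPlane := by
  left
  have := (Complex.re_le_norm (1 - z)).trans_lt hz
  simp at this
  exact this

/-- The connection formula for `₂F₁(a, 1 - a; 1; z)` between `z = 0` and `z = 1`. -/
theorem powSum_hypCoeff_one_sub {a : ℂ} (ha : ∀ k : ℤ, a ≠ k) {z : ℂ} (hz : ‖z‖ < 1)
    (hz1 : ‖1 - z‖ < 1) :
    powSum (hypCoeff a 1) (1 - z) =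
      (1 - powSum (harmCoeff a) (1 / 2) * powSum (derivCoeff (hypCoeff a 1)) (1 / 2)) *
        powSum (hypCoeff a 1) z + Complex.sin (Real.pi * a) / Real.pi * hypLog a z := by
  set F := powSum (hypCoeff a 1) with hFdef
  set F' := powSum (derivCoeff (hypCoeff a 1)) with hF'def
  set g := powSum (harmCoeff a) with hgdef
  set g' := powSum (derivCoeff (harmCoeff a)) with hg'def
  set ℓ : ℂ → ℂ := fun w => Complex.log ((1 - w) / w) with hℓdef
  set U : Set ℂ := Metric.ball 0 1 ∩ Metric.ball 1 1
  have hUo : IsOpen U := Metric.isOpen_ball.inter Metric.isOpen_ball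
  have hUc : Convex ℝ U := (convex_ball _ _).inter (convex_ball _ _)
  have hU (w : ℂ) : w ∈ U ↔ ‖w‖ < 1 ∧ ‖1 - w‖ < 1 := by
    simp only [U, Set.mem_inter_iff, Metric.mem_ball, dist_eq_norm, sub_zero, norm_sub_rev w 1]
  have hzU : z ∈ U := (hU z).2 ⟨hz, hz1⟩
  have hhU : (1 / 2 : ℂ) ∈ U := (hU _).2 ⟨norm_half_lt_one, by norm_num⟩
  have hone (w : ℂ) : HasDerivAt (fun w : ℂ => 1 - w) (-1) w := (hasDerivAt_id w).const_sub 1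
  have dF (w : ℂ) (hw : ‖w‖ < 1) : HasDerivAt F (F' w) w :=
    (discSummable_hypCoeff_one a).hasDerivAt hw
  have dg (w : ℂ) (hw : ‖w‖ < 1) : HasDerivAt g (g' w) w :=
    (discSummable_harmCoeff a).hasDerivAt hw
  have dΦ (w : ℂ) (hw : ‖w‖ < 1) := hasDerivAt_hyp_flux a hw
  have dΓ (w : ℂ) (hw : ‖w‖ < 1) := hasDerivAt_harm_flux a hw
  have dv (w : ℂ) (hw : ‖1 - w‖ < 1) : HasDerivAt (fun w => F (1 - w)) (F' (1 - w) * -1) w :=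
    HasDerivAt.comp w (dF _ hw) (hone w)
  have dV (w : ℂ) (hw : ‖1 - w‖ < 1) :
      HasDerivAt (fun w => (1 - w) * (1 - (1 - w)) * F' (1 - w))
        (a * (1 - a) * F (1 - w) * -1) w :=
    HasDerivAt.comp w (dΦ _ hw) (hone w)
  have dℓ (w : ℂ) (hw : w ∈ U) : HasDerivAt ℓ (-(w * (1 - w))⁻¹) w :=
    hasDerivAt_log_one_sub_div ((hU w).1 hw).1 (mem_slitPlane_of_norm_one_sub_lt ((hU w).1 hw).2)
  -- Up to sign, z(1 - z) times the Wronskian of F and F(1 - ·). The plus sign comes from the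
  -- derivative of 1 - z.
  have hB := eq_of_hasDerivAt_zero (f := fun w => F w * ((1 - w) * (1 - (1 - w)) * F' (1 - w)) +
    w * (1 - w) * F' w * F (1 - w)) hUo hUc (fun w hw => by
      obtain ⟨h1, h2⟩ := (hU w).1 hw
      refine (((dF w h1).fun_mul (dV w h2)).fun_add ((dΦ w h1).fun_mul (dv w h2))).congr_deriv ?_
      ring) hzU hhU
  -- The same for K and F(1 - ·). The term -F in z(1 - z)K' comes from differentiating the
  -- logarithm.
  have hC := eq_of_hasDerivAt_zero (f := fun w =>
    (2 * g w + ℓ w * F w) * ((1 - w) * (1 - (1 - w)) * F' (1 - w)) +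
    (2 * (w * (1 - w) * g' w) + ℓ w * (w * (1 - w) * F' w) - F w) * F (1 - w)) hUo hUc
    (fun w hw => by
      obtain ⟨h1, h2⟩ := (hU w).1 hw
      have hK := ((dg w h1).const_mul 2).fun_add ((dℓ w hw).fun_mul (dF w h1))
      have hψ := (((dΓ w h1).const_mul 2).fun_add ((dℓ w hw).fun_mul (dΦ w h1))).fun_sub (dF w h1)
      refine ((hK.fun_mul (dV w h2)).fun_add (hψ.fun_mul (dv w h2))).congr_deriv ?_
      have hw0 : w ≠ 0 :=
        Complex.slitPlane_ne_zero (mem_slitPlane_of_norm_one_sub_lt h2)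
      have hw1 : 1 - w ≠ 0 :=
        Complex.slitPlane_ne_zero (mem_slitPlane_of_norm_one_sub_lt (by simpa using h1))
      field_simp
      ring) hzU hhU
  have hW := hyp_harm_wronskian a hz
  have hWh := hyp_harm_wronskian a norm_half_lt_one
  have hS := hypHalf_mul_deriv ha
  have hℓ : ℓ (1 / 2) = 0 := by
    have : ((1 : ℂ) - 1 / 2) / (1 / 2) = 1 := by norm_num
    simp only [hℓdef, this, Complex.log_one]
  have e : (1 : ℂ) - 1 / 2 = 1 / 2 := by norm_num
  rw [hypHalf] at hS
  rw [← hFdef, ← hF'def, ← hgdef, ← hg'def] at hW hWh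
  rw [← hFdef, ← hF'def] at hS
  simp only [hℓ, e] at hB hC hWh
  have hL : hypLog a z = 2 * g z + ℓ z * F z := rfl
  rw [hL]
  -- With v = F(1 - ·), the identity v W(F,K) - K W(F,v) + F W(K,v) = 0 solves for v. `hWh` then
  -- removes g'(1/2) from the constants, and `hS` evaluates F(1/2)F'(1/2).
  linear_combination F (1 - z) * hW - F z * hC + (2 * g z + ℓ z * F z) * hB -
    F z * hWh + (2 * g z + ℓ z * F z) / 2 * hS

/-! ### Continuation to the slit disc and conclusion. -/

theorem hypergeometric_eq_powSum (a z : ℂ) :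
    ₂F₁ a (1 - a) 1 z = powSum (hypCoeff a 1) z := by
  rw [ordinaryHypergeometric_eq_tsum, powSum]
  refine tsum_congr fun n => ?_
  simp only [hypCoeff, poch, smul_eq_mul]
  congr 1
  rw [div_eq_mul_inv, mul_inv]
  ring

theorem gaussHyp_eq_powSum (a : ℂ) {z : ℂ} (hz : ‖z‖ < 1) :
    gaussHyp a (1 - a) 1 z = powSum (hypCoeff a 1) z := by
  rw [gaussHyp_eq_of_norm_lt_one _ _ _ hz, hypergeometric_eq_powSum]

theorem isOpen_slit_disc : IsOpen {w : ℂ | ‖w‖ < 1 ∧ w ∈ Complex.slitPlane} :=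
  (isOpen_lt continuous_norm continuous_const).inter Complex.isOpen_slitPlane

/-- The connection formula on the slit disc. -/
theorem gaussHyp_one_sub {a : ℂ} (ha : ∀ k : ℤ, a ≠ k) {x : ℂ} (hx : ‖x‖ < 1)
    (hx0 : x ∈ Complex.slitPlane) :
    gaussHyp a (1 - a) 1 (1 - x) =
      (1 - powSum (harmCoeff a) (1 / 2) * powSum (derivCoeff (hypCoeff a 1)) (1 / 2)) *
        powSum (hypCoeff a 1) x + Complex.sin (Real.pi * a) / Real.pi * hypLog a x := by
  set R : ℂ → ℂ := fun w =>
    (1 - powSum (harmCoeff a) (1 / 2) * powSum (derivCoeff (hypCoeff a 1)) (1 / 2)) *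
        powSum (hypCoeff a 1) w + Complex.sin (Real.pi * a) / Real.pi * hypLog a w with hR
  -- The continuation is glued from the series and the right-hand side R. The two agree on the lens
  -- by `powSum_hypCoeff_one_sub`, so f equals R(1 - z) on all of |1 - z| < 1.
  set f : ℂ → ℂ := fun z => if ‖z‖ < 1 then powSum (hypCoeff a 1) z else R (1 - z) with hf
  have hf0 : ∀ z, ‖z‖ < 1 → f =ᶠ[𝓝 z] powSum (hypCoeff a 1) := fun z hz => by
    filter_upwards [Metric.isOpen_ball.mem_nhds (mem_ball_zero_iff.2 hz)] with w hw
    rw [mem_ball_zero_iff] at hw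
    simp [hf, hw]
  have hf1 : ∀ z, ‖1 - z‖ < 1 → f z = R (1 - z) := fun z h1 => by
    simp only [hf]
    split_ifs with h
    · have := powSum_hypCoeff_one_sub ha h1 (by simpa using h)
      rwa [sub_sub_cancel] at this
    · rfl
  set S : Set ℂ := {z : ℂ | ‖1 - z‖ < 1 ∧ 1 - z ∈ Complex.slitPlane}
  have hS : IsOpen S := isOpen_slit_disc.preimage (continuous_const.sub continuous_id)
  have hRd : DifferentiableOn ℂ (fun z => R (1 - z)) S := fun z hz => by
    have h1 : DifferentiableAt ℂ R (1 - z) :=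
      (((discSummable_hypCoeff_one a).hasDerivAt hz.1).differentiableAt.const_mul _).fun_add
        ((differentiableAt_hypLog a hz.1 hz.2).const_mul _)
    exact (h1.comp z (by fun_prop : DifferentiableAt ℂ (fun z : ℂ => 1 - z)
      z)).differentiableWithinAt
  have hFd : DifferentiableOn ℂ (powSum (hypCoeff a 1)) (Metric.ball 0 1) := fun z hz =>
    ((discSummable_hypCoeff_one a).hasDerivAt
      (mem_ball_zero_iff.1 hz)).differentiableAt.differentiableWithinAt
  rw [gaussHyp_eq_of_analyticOnNhd (f := f) ?_ ?_, hf1 _ (by simpa using hx), sub_sub_cancel]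
  · intro z hz
    by_cases hz1 : ‖z‖ < 1
    · exact (hFd.analyticAt (Metric.isOpen_ball.mem_nhds (mem_ball_zero_iff.2 hz1))).congr
        (hf0 z hz1).symm
    · have hzS : z ∈ S := by
        rw [segment_eq_image] at hz
        obtain ⟨t, ⟨ht0, ht1⟩, rfl⟩ := hz
        -- The parameter t = 0 gives the origin, which lies in the unit disc. For t > 0 the bound (1
        -- - t) + t‖x‖ < 1 is strict, and the slit plane is star-shaped about 1.
        have ht : 0 < t := by
          refine lt_of_le_of_ne ht0 ?_
          rintro rfl
          simp at hz1
        have he : 1 - ((1 - t) • (0 : ℂ) + t • (1 - x)) = (1 - t) • (1 : ℂ) + t • x := by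
          simp only [Complex.real_smul]; push_cast; ring
        refine ⟨?_, ?_⟩
        · rw [he]
          refine (norm_add_le _ _).trans_lt ?_
          rw [norm_smul, norm_smul, norm_one, Real.norm_of_nonneg ht0,
            Real.norm_of_nonneg (sub_nonneg.2 ht1)]
          nlinarith
        · rw [he]
          exact Complex.starConvex_one_slitPlane hx0 (sub_nonneg.2 ht1) ht0 (by ring)
      refine (hRd.analyticAt (hS.mem_nhds hzS)).congr ?_
      filter_upwards [hS.mem_nhds hzS] with w hw
      exact (hf1 w hw.1).symm
  · refine (hf0 0 (by simp)).trans (.of_forall fun z => ?_)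
    exact (hypergeometric_eq_powSum a z).symm

/-- `x` ranges over the open unit disc cut along `(-1, 0]`. -/
theorem theorem2 (a : ℂ) (ha : ∀ k : ℤ, a ≠ k) (x : ℂ) (hx : ‖x‖ < 1)
    (hx0 : x ∈ Complex.slitPlane) :
    HasSum
      (fun n : ℕ =>
        (ascPochhammer ℂ (n + 1)).eval a * (ascPochhammer ℂ (n + 1)).eval (1 - a)
            / ((n + 1).factorial : ℂ) ^ 2
          * ((harmonic (n + 1) : ℚ) : ℂ) * x ^ (n + 1))
      ((Real.pi : ℂ) / (2 * Complex.sin (Real.pi * a)) * gaussHyp a (1 - a) 1 (1 - x)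
        + 1 / 2 * (Complex.digamma (1 - a / 2) + Complex.digamma ((a + 1) / 2)
            - Complex.digamma 1 - Complex.digamma (1 / 2)
            - (Real.pi : ℂ) / Complex.sin (Real.pi * a) - Complex.log ((1 - x) / x))
          * gaussHyp a (1 - a) 1 x) := by
  -- The term n = 0 is dropped; it vanishes because H_0 = 0.
  have h := (hasSum_nat_add_iff' 1).2 ((discSummable_harmCoeff a).hasSum hx)
  have hpi : (Real.pi : ℂ) ≠ 0 := mod_cast Real.pi_ne_zero
  have hs := sin_pi_mul_ne_zero_of_ne_intCast ha
  have hg := powSum_harmCoeff_half ha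
  have hF := hypHalf_mul_deriv ha
  rw [gaussHyp_one_sub ha hx hx0, gaussHyp_eq_powSum a hx, hypLog, hg]
  simp only [Finset.range_one, Finset.sum_singleton, harmCoeff, harmonic_zero, Rat.cast_zero,
    mul_zero, zero_mul, sub_zero] at h
  have hterm (n : ℕ) : (ascPochhammer ℂ (n + 1)).eval a * (ascPochhammer ℂ (n + 1)).eval (1 - a)
      / ((n + 1).factorial : ℂ) ^ 2 * ((harmonic (n + 1) : ℚ) : ℂ) * x ^ (n + 1) =
      hypCoeff a 1 (n + 1) * ((harmonic (n + 1) : ℚ) : ℂ) * x ^ (n + 1) := by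
    rw [hypCoeff, poch_one, poch, poch]
    rw [sq]
  have hsum := h.congr_fun hterm
  refine Eq.subst (motive := fun v => HasSum _ v) ?_ hsum
  symm
  set D := Complex.digamma (1 - a / 2) + Complex.digamma ((a + 1) / 2)
    - Complex.digamma 1 - Complex.digamma (1 / 2)
  -- Here g(1/2)F'(1/2) becomes D sin(πa)/π, and what remains is linear algebra in F(x) and g(x).
  rw [mul_assoc (1 / 2 * D), hF]
  field_simp
  ring
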